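/- Let $a,\rho_s,u_s,\kappa,\mu>0$ and $\gamma\ge 1$ be real, and put $b=a\gamma\rho_s^{\gamma-2}$. Let $0\le l_1<l_2<2\pi$, $\mathcal O=(l_1,l_2)$ and $T>0$. Consider on $(0,T)\times(0,2\pi)$ the control system $$\begin{cases}\partial_t\rho+u_s\partial_x\rho+\rho_s\partial_xu=\mathbf 1_{\mathcal O}f_1,\\ \partial_tu+u_s\partial_xu+b\,\partial_x\rho-\frac1{\rho_s}\partial_xS=\mathbf 1_{\mathcal O}f_2,\\ \partial_tS+\frac1\kappa S-\frac\mu\kappa\partial_xu=\mathbf 1_{\mathcal O}f_3,\end{cases}$$ with periodic boundary conditions $\rho(t,0)=\rho(t,2\pi)$, $u(t,0)=u(t,2\pi)$, $S(t,0)=S(t,2\pi)$ and initial condition $(\rho,u,S)(0,\cdot)=(\rho_0,u_0,S_0)$. Its solution $(\rho,u,S)\in C([0,T];L^2(0,2\pi)^3)$ (complex-valued) is understood in the weak sense, i.e. tested against smooth $2\pi$-periodic functions of $x$. The system is called exactly controllable in $L^2(0,2\pi)^3$ at time $T$ if for all $(\rho_0,u_0,S_0),(\rho_1,u_1,S_1)\in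 L^2(0,2\pi)^3$ there are controls $f_1,f_2,f_3\in L^2(0,T;L^2(\mathcal O))$ such that the corresponding solution satisfies $(\rho,u,S)(T,\cdot)=(\rho_1,u_1,S_1)$. Let $\beta_1,\beta_2,\beta_3$ be the roots (which are real, distinct and nonzero) of $$r^3+2u_sr^2+\Big(u_s^2-b\rho_s-\frac{\mu}{\kappa\rho_s}\Big)r-\frac{\mu u_s}{\kappa\rho_s}=0,$$ and let $\beta=\min\{|\beta_1|,|\beta_2|,|\beta_3|\}$. If $\beta T<\max\{l_1,\,2\pi-l_2\}$, then the system is not exactly controllable in $L^2(0,2\pi)^3$ at time $T$, even with the controls $f_1,f_2,f_3$ acting in all three equations. -/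

import Mathlib

open MeasureTheory Set
open scoped ContDiff

noncomputable section

namespace MaxwellNS

/-- The space `L²(s)` of complex-valued functions on a set `s` of real numbers. -/
abbrev L2On (s : Set ℝ) : Type := Lp ℂ 2 (volume.restrict s)

/-- The space `L²(0, 2π)`. -/
abbrev L2Per : Type := L2On (Ioo 0 (2 * Real.pi))

/-- The space of controls `L²(0, T; L²(O))`. -/
abbrev ControlSpace (T : ℝ) (O : Set ℝ) : Type := Lp (L2On O) 2 (volume.restrict (Ioo 0 T))

/-- The bilinear pairing `∫_s g φ dx`. For a control value `g ∈ L²(O)` this is the pairing of the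
extension by zero `𝟙_O g` with `φ`. -/
def pair {s : Set ℝ} (g : L2On s) (φ : ℝ → ℂ) : ℂ := ∫ x in s, g x * φ x

/-- Test functions in space: smooth and `2π`-periodic on the real line. -/
def IsTest (φ : ℝ → ℂ) : Prop := ContDiff ℝ ∞ φ ∧ Function.Periodic φ (2 * Real.pi)

/-- `(ρ, u, S) ∈ C([0, T]; L²(0, 2π)³)` is the (weak) solution, with `2π`-periodic boundary
conditions and initial data `(ρ₀, u₀, S₀)`, of
* `∂ₜρ + us ∂ₓρ + ρs ∂ₓu = 𝟙_{O₁} f₁`,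
* `∂ₜu + us ∂ₓu + b ∂ₓρ - (1/ρs) ∂ₓS = 𝟙_{O₂} f₂`,
* `∂ₜS + (1/κ) S - (μ/κ) ∂ₓu = 𝟙_{O₃} f₃`.

The equations are tested with all smooth `2π`-periodic functions of `x` and integrated in time;
the test functions need not vanish at `0` and `2π`, which encodes the periodic boundary
conditions. -/
structure IsSolution (b ρs us κ μ T : ℝ) {O₁ O₂ O₃ : Set ℝ}
    (f₁ : ControlSpace T O₁) (f₂ : ControlSpace T O₂) (f₃ : ControlSpace T O₃)
    (ρ₀ u₀ S₀ : L2Per) (ρ u S : ℝ → L2Per) : Prop where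
  continuousOn_density : ContinuousOn ρ (Icc 0 T)
  continuousOn_velocity : ContinuousOn u (Icc 0 T)
  continuousOn_stress : ContinuousOn S (Icc 0 T)
  initial_density : ρ 0 = ρ₀
  initial_velocity : u 0 = u₀
  initial_stress : S 0 = S₀
  density_eq : ∀ φ : ℝ → ℂ, IsTest φ → ∀ t ∈ Icc 0 T,
    pair (ρ t) φ = pair ρ₀ φ
      + ∫ τ in (0 : ℝ)..t, (us * pair (ρ τ) (deriv φ) + ρs * pair (u τ) (deriv φ)
          + pair (f₁ τ) φ)
  velocity_eq : ∀ φ : ℝ → ℂ, IsTest φ → ∀ t ∈ Icc 0 T,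
    pair (u t) φ = pair u₀ φ
      + ∫ τ in (0 : ℝ)..t, (us * pair (u τ) (deriv φ) + b * pair (ρ τ) (deriv φ)
          - (1 / ρs) * pair (S τ) (deriv φ) + pair (f₂ τ) φ)
  stress_eq : ∀ φ : ℝ → ℂ, IsTest φ → ∀ t ∈ Icc 0 T,
    pair (S t) φ = pair S₀ φ
      + ∫ τ in (0 : ℝ)..t, (-(1 / κ) * pair (S τ) φ - (μ / κ) * pair (u τ) (deriv φ)
          + pair (f₃ τ) φ)

/-- Exact controllability in `L²(0, 2π)³` at time `T`, with controls `fᵢ ∈ L²(0, T; L²(Oᵢ))` acting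
in the three equations: every initial state can be steered to every final state. -/
def ExactlyControllable (b ρs us κ μ T : ℝ) (O₁ O₂ O₃ : Set ℝ) : Prop :=
  ∀ ρ₀ u₀ S₀ ρ₁ u₁ S₁ : L2Per,
    ∃ (f₁ : ControlSpace T O₁) (f₂ : ControlSpace T O₂) (f₃ : ControlSpace T O₃)
      (ρ u S : ℝ → L2Per),
      IsSolution b ρs us κ μ T f₁ f₂ f₃ ρ₀ u₀ S₀ ρ u S ∧ ρ T = ρ₁ ∧ u T = u₁ ∧ S T = S₁

open Polynomial in
/-- The cubic `r³ + 2 us r² + (us² - b ρs - μ/(κ ρs)) r - μ us/(κ ρs)`, whose roots are the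
characteristic speeds of the system. -/
def speedPoly (b ρs us κ μ : ℝ) : ℝ[X] :=
  X ^ 3 + C (2 * us) * X ^ 2 + C (us ^ 2 - b * ρs - μ / (κ * ρs)) * X - C (μ * us / (κ * ρs))

open Polynomial in
/-- For positive parameters the cubic has three distinct, nonzero real roots, so it makes sense to
name them. -/
theorem exists_roots_speedPoly {b ρs us κ μ : ℝ} (hb : 0 < b) (hρ : 0 < ρs) (hu : 0 < us)
    (hκ : 0 < κ) (hμ : 0 < μ) :
    ∃ β₁ β₂ β₃ : ℝ, (speedPoly b ρs us κ μ).roots = {β₁, β₂, β₃} ∧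
      β₁ < β₂ ∧ β₂ < 0 ∧ 0 < β₃ := by
  set P := speedPoly b ρs us κ μ with hP
  set m := μ / (κ * ρs) with hm
  have hm0 : 0 < m := by positivity
  have hev : ∀ r, P.eval r = r ^ 3 + 2 * us * r ^ 2 + (us ^ 2 - b * ρs - m) * r - m * us := by
    intro r
    simp only [hP, speedPoly, eval_sub, eval_add, eval_mul, eval_pow, eval_X, eval_C, hm]
    ring
  have hbρ : 0 < b * ρs := by positivity
  set K := 1 + 2 * us + b * ρs + m + us ^ 2 with hK
  have hcont : Continuous fun r => P.eval r := P.continuous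
  have h0 : P.eval 0 < 0 := by rw [hev]; nlinarith [mul_pos hm0 hu]
  have hmu : 0 < P.eval (-us) := by
    rw [hev]; nlinarith [mul_pos hbρ hu]
  have hKpos : 0 < P.eval K := by
    rw [hev]
    have h1 : 1 ≤ K := by nlinarith [sq_nonneg us]
    have h2 : b * ρs + m + us ≤ K := by nlinarith [sq_nonneg us]
    have h3 : (b * ρs + m + us) * K ≤ K ^ 2 := by nlinarith
    have h4 : K ^ 2 ≤ K ^ 3 := by nlinarith [sq_nonneg K]
    nlinarith [mul_pos hm0 hu, mul_pos hu (by linarith : 0 < K), mul_nonneg hu.le (sq_nonneg K),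
      mul_nonneg (sq_nonneg us) (by linarith : 0 ≤ K), sq_nonneg us,
      mul_le_mul_of_nonneg_left h2 hu.le, mul_le_mul_of_nonneg_left h1 hu.le]
  have hKneg : P.eval (-us - K) < 0 := by
    rw [hev]
    have e : (-us - K) ^ 3 + 2 * us * (-us - K) ^ 2 + (us ^ 2 - b * ρs - m) * (-us - K) - m * us
        = -K ^ 2 * (us + K) + (b * ρs) * (us + K) + m * K := by ring
    rw [e]
    have h1 : 1 ≤ K := by nlinarith [sq_nonneg us]
    have h2 : b * ρs + m < K := by nlinarith [sq_nonneg us]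
    have h3 : K ≤ K ^ 2 := by nlinarith
    nlinarith [mul_pos hm0 hu, mul_pos (by nlinarith : 0 < K ^ 2 - b * ρs - m)
      (by linarith : 0 < us + K)]
  have hK0 : 0 < K := by nlinarith [sq_nonneg us]
  obtain ⟨β₁, ⟨ha1, hb1⟩, hr1⟩ := intermediate_value_Ioo (by linarith : -us - K ≤ -us)
    hcont.continuousOn ⟨hKneg, hmu⟩
  obtain ⟨β₂, ⟨ha2, hb2⟩, hr2⟩ := intermediate_value_Ioo' (by linarith : -us ≤ 0)
    hcont.continuousOn ⟨h0, hmu⟩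
  obtain ⟨β₃, ⟨ha3, hb3⟩, hr3⟩ := intermediate_value_Ioo hK0.le
    hcont.continuousOn ⟨h0, hKpos⟩
  refine ⟨β₁, β₂, β₃, ?_, by linarith, hb2, ha3⟩
  have hP0 : P ≠ 0 := fun h => by simp [h] at h0
  have hdeg : P.natDegree ≤ 3 := by
    rw [hP, speedPoly]; compute_degree
  have hle : ({β₁, β₂, β₃} : Multiset ℝ) ≤ P.roots := by
    rw [Multiset.le_iff_subset]
    · intro x hx
      simp only [Multiset.insert_eq_cons, Multiset.mem_cons, Multiset.mem_singleton] at hx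
      rw [mem_roots hP0]
      rcases hx with rfl | rfl | rfl
      exacts [hr1, hr2, hr3]
    · simp only [Multiset.insert_eq_cons, Multiset.nodup_cons, Multiset.mem_cons,
        Multiset.mem_singleton, Multiset.nodup_singleton, and_true, not_or]
      exact ⟨⟨by linarith, by linarith⟩, by linarith⟩
  refine (Multiset.eq_of_le_of_card_le hle ?_).symm
  exact (P.card_roots'.trans hdeg).trans (by simp)

end MaxwellNS

end

noncomputable section

/-! High-frequency wave packets solve the adjoint system approximately and can travel without
meeting the control. Let `r` be a characteristic speed with `|r| = β`. In the coordinate `x + r t`,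
the control interval sweeps out an arc of length `l₂ - l₁ + β T` during `[0, T]`. The hypothesis
makes this less than `2π`, so some nonzero smooth `g` vanishes on the arc. Test the equations
against `e^{ct} (i n v + w) e^{in(x + r t)} g(x + r t)`, a two-term WKB ansatz. The controls drop
out. The choice of `v` cancels order `n²`, and that of `w` and `c` cancels order `n`, so the pairing
with the solution has a time derivative bounded uniformly in `n`. Starting from rest and ending at
`(0, 0, S₁)`, this forces the pairing of `S₁` with the packet to be `O(1/n)`
(`IsSolution.exists_bound_wavePacket`). By Banach–Steinhaus this fails for some `S₁` in `L²`
(`exists_unbounded_pair_wavePacket`). The amplitudes exist because the characteristic roots are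
simple (`exists_amplitudes`). -/

namespace MaxwellNS

/-! ### Periodic test functions and the pairing on `L²(0, 2π)` -/

namespace IsTest

variable {φ ψ : ℝ → ℂ}

theorem continuous (h : IsTest φ) : Continuous φ := h.1.continuous

theorem differentiable (h : IsTest φ) : Differentiable ℝ φ := h.1.differentiable (by simp)

theorem mul (h : IsTest φ) (h' : IsTest ψ) : IsTest (fun x => φ x * ψ x) :=
  ⟨h.1.mul h'.1, fun x => by simp only [h.2 x, h'.2 x]⟩

theorem deriv (h : IsTest φ) : IsTest (deriv φ) := by
  refine ⟨(contDiff_infty_iff_deriv.1 h.1).2, fun x => ?_⟩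
  rw [← deriv_comp_add_const]
  exact congrArg (fun f => _root_.deriv f x) (funext h.2)

theorem translate (h : IsTest φ) (c : ℝ) : IsTest (fun x => φ (x + c)) := by
  refine ⟨h.1.comp (contDiff_id.add contDiff_const), fun x => ?_⟩
  change φ (x + 2 * Real.pi + c) = φ (x + c)
  rw [add_right_comm, h.2]

theorem exists_bound (h : IsTest φ) : ∃ C, 0 ≤ C ∧ ∀ x, ‖φ x‖ ≤ C := by
  obtain ⟨C, hC⟩ := (h.2.isBounded_of_continuous (by positivity) h.continuous).exists_norm_le
  exact ⟨C, (norm_nonneg _).trans (hC _ ⟨0, rfl⟩), fun x => hC _ ⟨x, rfl⟩⟩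

theorem memLp (h : IsTest φ) : MemLp φ 2 (volume.restrict (Ioo 0 (2 * Real.pi))) := by
  obtain ⟨C, -, hC⟩ := h.exists_bound
  exact MemLp.of_bound h.continuous.aestronglyMeasurable C (.of_forall hC)

/-- The class in `L²(0, 2π)` of a test function. -/
def toL2 (h : IsTest φ) : L2Per := h.memLp.toLp

end IsTest

/-- The bilinear pairing of `L²(0, 2π)` with itself. -/
def pairL2 : L2Per →L[ℂ] L2Per →L[ℂ] ℂ :=
  (ContinuousLinearMap.mul ℂ ℂ).lpPairing (volume.restrict (Ioo 0 (2 * Real.pi))) 2 2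

theorem pair_eq_pairL2 {φ : ℝ → ℂ} (h : IsTest φ) (g : L2Per) : pair g φ = pairL2 g h.toL2 := by
  rw [pairL2, ContinuousLinearMap.lpPairing_eq_integral]
  refine integral_congr_ae ?_
  filter_upwards [h.memLp.coeFn_toLp] with x hx
  simp only [IsTest.toL2, hx, ContinuousLinearMap.mul_apply']

/-- The factor by which the uniform norm dominates the norm of `L²(0, 2π)`. -/
def circleConst : ℝ :=
  (measureUnivNNReal (volume.restrict (Ioo 0 (2 * Real.pi)))) ^ (2 : ENNReal).toReal⁻¹

theorem circleConst_nonneg : 0 ≤ circleConst := by unfold circleConst; positivity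

theorem norm_le_of_ae_eq {g : L2Per} {φ : ℝ → ℂ} {C : ℝ} (hC : 0 ≤ C)
    (h : g =ᵐ[volume.restrict (Ioo 0 (2 * Real.pi))] φ) (hφ : ∀ x, ‖φ x‖ ≤ C) :
    ‖g‖ ≤ circleConst * C := by
  refine Lp.norm_le_of_ae_bound hC ?_
  filter_upwards [h] with x hx
  rw [hx]; exact hφ x

theorem IsTest.norm_toL2_le {φ : ℝ → ℂ} (h : IsTest φ) {C : ℝ} (hC : 0 ≤ C)
    (hφ : ∀ x, ‖φ x‖ ≤ C) : ‖h.toL2‖ ≤ circleConst * C :=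
  norm_le_of_ae_eq hC h.memLp.coeFn_toLp hφ

theorem norm_pair_le {φ : ℝ → ℂ} (h : IsTest φ) {C : ℝ} (hC : 0 ≤ C) (hφ : ∀ x, ‖φ x‖ ≤ C)
    (g : L2Per) : ‖pair g φ‖ ≤ ‖pairL2‖ * (circleConst * C) * ‖g‖ := by
  rw [pair_eq_pairL2 h]
  calc _ ≤ ‖pairL2‖ * ‖g‖ * ‖h.toL2‖ := pairL2.le_opNorm₂ _ _
    _ ≤ ‖pairL2‖ * ‖g‖ * (circleConst * C) := by gcongr; exact h.norm_toL2_le hC hφ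
    _ = _ := by ring

theorem continuousOn_pair {φ : ℝ → ℂ} (h : IsTest φ) {y : ℝ → L2Per} {s : Set ℝ}
    (hy : ContinuousOn y s) : ContinuousOn (fun t => pair (y t) φ) s := by
  simp only [pair_eq_pairL2 h]
  exact (pairL2.flip h.toL2).continuous.comp_continuousOn hy

theorem IsTest.integrable_mul {φ : ℝ → ℂ} (h : IsTest φ) (g : L2Per) :
    IntegrableOn (fun x => g x * φ x) (Ioo 0 (2 * Real.pi)) :=
  (Lp.memLp g).integrable_mul h.memLp

/-! ### Differentiation in time of pairings with travelling test functions -/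

/-- First-order Taylor estimate for a function with Lipschitz derivative. -/
theorem norm_taylor_le {G : ℝ → ℂ} (hG : Differentiable ℝ G) (hG' : Differentiable ℝ (deriv G))
    {C : ℝ} (hC : ∀ x, ‖deriv (deriv G) x‖ ≤ C) (θ h : ℝ) :
    ‖G (θ + h) - G θ - h * deriv G θ‖ ≤ C * h ^ 2 := by
  have hlip : ∀ s, ‖deriv G (θ + s) - deriv G θ‖ ≤ C * |s| := fun s => by
    simpa using Convex.norm_image_sub_le_of_norm_deriv_le (f := deriv G) (s := univ) (x := θ)
      (y := θ + s) (fun x _ => hG' x) (fun x _ => hC x) convex_univ (mem_univ _) (mem_univ _)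
  have hd : ∀ s, HasDerivAt (fun s : ℝ => G (θ + s) - s * deriv G θ)
      (deriv G (θ + s) - deriv G θ) s := fun s => by
    have h1 : HasDerivAt (fun s : ℝ => G (θ + s)) (deriv G (θ + s)) s :=
      HasDerivAt.comp_const_add θ s (hG _).hasDerivAt
    have h2 := (HasDerivAt.ofReal_comp (hasDerivAt_id s)).mul_const (deriv G θ)
    rw [Complex.ofReal_one, one_mul] at h2
    exact h1.sub h2
  have h0 : 0 ≤ C := (norm_nonneg _).trans (hC 0)
  have := Convex.norm_image_sub_le_of_norm_hasDerivWithin_le (C := C * |h|) (s := uIcc 0 h)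
    (x := 0) (y := h) (fun s _ => (hd s).hasDerivWithinAt) (fun s hs => (hlip s).trans ?_)
    (convex_uIcc 0 h) left_mem_uIcc right_mem_uIcc
  · calc _ = ‖G (θ + h) - h * deriv G θ - (G (θ + 0) - (0 : ℝ) * deriv G θ)‖ := by
          congr 1; push_cast; rw [add_zero]; ring
      _ ≤ C * |h| * ‖h - 0‖ := this
      _ = C * h ^ 2 := by rw [sub_zero, Real.norm_eq_abs, mul_assoc, abs_mul_abs_self, sq]
  · have : |s| ≤ |h| := by simpa using abs_sub_left_of_mem_uIcc hs
    gcongr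

theorem IsTest.hasDerivAt_toL2_translate {G : ℝ → ℂ} (hG : IsTest G) (β t₀ : ℝ) :
    HasDerivAt (fun t => (hG.translate (β * t)).toL2)
      ((β : ℂ) • (hG.deriv.translate (β * t₀)).toL2) t₀ := by
  obtain ⟨C, hC0, hC⟩ := hG.deriv.deriv.exists_bound
  rw [hasDerivAt_iff_isLittleO]
  have hO : (fun t => (hG.translate (β * t)).toL2 - (hG.translate (β * t₀)).toL2
      - (t - t₀) • ((β : ℂ) • (hG.deriv.translate (β * t₀)).toL2))
      =O[nhds t₀] fun t => (t - t₀) ^ 2 := by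
    refine Asymptotics.IsBigO.of_bound (circleConst * (C * β ^ 2)) (.of_forall fun t => ?_)
    have hb : ∀ x, ‖G (x + β * t) - G (x + β * t₀)
        - (t - t₀) • ((β : ℂ) * _root_.deriv G (x + β * t₀))‖ ≤ C * β ^ 2 * (t - t₀) ^ 2 := by
      intro x
      have := norm_taylor_le hG.differentiable hG.deriv.differentiable hC (x + β * t₀)
        (β * (t - t₀))
      calc _ = ‖G (x + β * t₀ + β * (t - t₀)) - G (x + β * t₀)
            - (β * (t - t₀) : ℝ) * _root_.deriv G (x + β * t₀)‖ := by
            congr 2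
            · congr 2; ring
            · rw [Complex.real_smul]; push_cast; ring
        _ ≤ _ := this
        _ = _ := by ring
    calc _ ≤ circleConst * (C * β ^ 2 * (t - t₀) ^ 2) := by
          refine norm_le_of_ae_eq (by positivity) ?_ hb
          filter_upwards [(hG.translate (β * t)).memLp.coeFn_toLp,
            (hG.translate (β * t₀)).memLp.coeFn_toLp,
            (hG.deriv.translate (β * t₀)).memLp.coeFn_toLp,
            Lp.coeFn_sub ((hG.translate (β * t)).toL2 - (hG.translate (β * t₀)).toL2)
              ((t - t₀) • ((β : ℂ) • (hG.deriv.translate (β * t₀)).toL2)),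
            Lp.coeFn_sub (hG.translate (β * t)).toL2 (hG.translate (β * t₀)).toL2,
            Lp.coeFn_smul (t - t₀) ((β : ℂ) • (hG.deriv.translate (β * t₀)).toL2),
            Lp.coeFn_smul (β : ℂ) (hG.deriv.translate (β * t₀)).toL2]
            with x h1 h2 h3 h4 h5 h6 h7
          rw [h4, Pi.sub_apply, h5, Pi.sub_apply, h6, Pi.smul_apply, h7, Pi.smul_apply]
          simp only [IsTest.toL2, h1, h2, h3, smul_eq_mul]
      _ = _ := by rw [Real.norm_of_nonneg (sq_nonneg _)]; ring
  refine hO.trans_isLittleO ?_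
  have := (Asymptotics.isLittleO_pow_id (𝕜 := ℝ) (n := 2) (by norm_num)).comp_tendsto
    (k := fun t => t - t₀) (l' := nhds t₀)
    (Continuous.tendsto' (by fun_prop) _ _ (sub_self t₀))
  exact this

/-- A product rule in which `y` is only norm continuous and weakly differentiable against the test
function frozen at `t₀`. This suffices because the translates are differentiable in the `L²` norm:
split the increment into the change of the test function, paired with `y t`, and the change of `y`
against the frozen one. -/
theorem hasDerivWithinAt_pair_translate {y : ℝ → L2Per} {s : Set ℝ} (hy : ContinuousOn y s)
    {G : ℝ → ℂ} (hG : IsTest G) (β : ℝ) {t₀ : ℝ} (ht₀ : t₀ ∈ s) {H : ℂ}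
    (hH : HasDerivWithinAt (fun t => pair (y t) fun x => G (x + β * t₀)) H s t₀) :
    HasDerivWithinAt (fun t => pair (y t) fun x => G (x + β * t))
      (β * pair (y t₀) (fun x => deriv G (x + β * t₀)) + H) s t₀ := by
  rw [hasDerivWithinAt_iff_tendsto_slope] at hH ⊢
  have h1 := hasDerivWithinAt_iff_tendsto_slope.1
    ((hG.hasDerivAt_toL2_translate β t₀).hasDerivWithinAt (s := s))
  have h2 : Filter.Tendsto y (nhdsWithin t₀ (s \ {t₀})) (nhds (y t₀)) :=
    (hy t₀ ht₀).mono_left (nhdsWithin_mono _ sdiff_subset)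
  have h3 := ((pairL2.continuous₂.tendsto (y t₀, _)).comp (h2.prodMk_nhds h1)).add hH
  have e : Function.uncurry (fun x y => pairL2 x y)
      (y t₀, (β : ℂ) • (hG.deriv.translate (β * t₀)).toL2) + H
      = β * pair (y t₀) (fun x => deriv G (x + β * t₀)) + H := by
    rw [pair_eq_pairL2 (hG.deriv.translate _), Function.uncurry_apply_pair, map_smul, smul_eq_mul]
  rw [← e]
  refine h3.congr fun t => ?_
  simp only [slope_def_module, Function.comp, pair_eq_pairL2 (hG.translate _),
    Function.uncurry_apply_pair, ContinuousLinearMap.map_smul_of_tower, map_sub, ← smul_add,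
    sub_add_sub_cancel]

theorem hasDerivWithinAt_integral_of_continuousOn {T t₀ : ℝ} {k : ℝ → ℂ}
    (hk : ContinuousOn k (Icc 0 T)) (ht₀ : t₀ ∈ Icc 0 T) :
    HasDerivWithinAt (fun t => ∫ τ in (0 : ℝ)..t, k τ) (k t₀) (Icc 0 T) t₀ := by
  have hT : 0 ≤ T := ht₀.1.trans ht₀.2
  -- Extending `k` by constants beyond `[0, T]` gives the fundamental theorem of calculus at the
  -- endpoints too.
  have hc : Continuous (IccExtend hT ((Icc 0 T).domRestrict k)) := hk.domRestrict.Icc_extend'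
  have he : ∀ t ∈ Icc 0 T, IccExtend hT ((Icc 0 T).domRestrict k) t = k t := fun t ht => by
    rw [IccExtend_of_mem _ _ ht]; rfl
  have := (intervalIntegral.integral_hasDerivAt_right (hc.intervalIntegrable 0 t₀)
    (hc.stronglyMeasurableAtFilter _ _) hc.continuousAt).hasDerivWithinAt (s := Icc 0 T)
  rw [he t₀ ht₀] at this
  have hI : ∀ t ∈ Icc 0 T, (∫ τ in (0 : ℝ)..t, k τ)
      = ∫ τ in (0 : ℝ)..t, IccExtend hT ((Icc 0 T).domRestrict k) τ := fun t ht => by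
    refine intervalIntegral.integral_congr fun τ hτ => ?_
    rw [uIcc_of_le ht.1] at hτ
    exact (he τ ⟨hτ.1, hτ.2.trans ht.2⟩).symm
  exact this.congr hI (hI t₀ ht₀)

theorem pair_eq_zero {s : Set ℝ} (hs : MeasurableSet s) {φ : ℝ → ℂ} (h : ∀ x ∈ s, φ x = 0)
    (g : L2On s) : pair g φ = 0 := by
  rw [pair, setIntegral_congr_fun (g := fun _ => 0) hs fun x hx => by simp [h x hx]]
  simp


theorem pair_const_mul_add {φ ψ : ℝ → ℂ} (hφ : IsTest φ) (hψ : IsTest ψ) (c : ℂ) (g : L2Per) :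
    pair g (fun x => c * φ x + ψ x) = c * pair g φ + pair g ψ := by
  simp only [pair]
  rw [← integral_const_mul, ← integral_add ((hφ.integrable_mul g).const_mul c)
    (hψ.integrable_mul g)]
  congr 1 with x
  ring

/-! ### The weak equations away from the control region -/

namespace IsSolution

variable {b ρs us κ μ T : ℝ} {O : Set ℝ} {f₁ f₂ f₃ : ControlSpace T O}
  {ρ₀ u₀ S₀ : L2Per} {ρ u S : ℝ → L2Per} {φ : ℝ → ℂ} {t : ℝ}

/-- Since the test function vanishes on `O`, the control, merely `L²` in time, disappears. The
remaining integrand is continuous, so the integrated equation can be differentiated at every time.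
-/
theorem hasDerivWithinAt_density (h : IsSolution b ρs us κ μ T f₁ f₂ f₃ ρ₀ u₀ S₀ ρ u S)
    (hO : MeasurableSet O) (hφ : IsTest φ) (hφO : ∀ x ∈ O, φ x = 0) (ht : t ∈ Icc 0 T) :
    HasDerivWithinAt (fun t => pair (ρ t) φ)
      (us * pair (ρ t) (deriv φ) + ρs * pair (u t) (deriv φ)) (Icc 0 T) t := by
  have hk : ContinuousOn (fun τ => us * pair (ρ τ) (deriv φ) + ρs * pair (u τ) (deriv φ))
      (Icc 0 T) :=
    (continuousOn_const.mul (continuousOn_pair hφ.deriv h.continuousOn_density)).add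
      (continuousOn_const.mul (continuousOn_pair hφ.deriv h.continuousOn_velocity))
  have he := h.density_eq φ hφ
  simp only [pair_eq_zero hO hφO, add_zero] at he
  exact ((hasDerivWithinAt_integral_of_continuousOn hk ht).const_add _).congr he (he t ht)

theorem hasDerivWithinAt_velocity (h : IsSolution b ρs us κ μ T f₁ f₂ f₃ ρ₀ u₀ S₀ ρ u S)
    (hO : MeasurableSet O) (hφ : IsTest φ) (hφO : ∀ x ∈ O, φ x = 0) (ht : t ∈ Icc 0 T) :
    HasDerivWithinAt (fun t => pair (u t) φ)
      (us * pair (u t) (deriv φ) + b * pair (ρ t) (deriv φ) - (1 / ρs) * pair (S t) (deriv φ))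
      (Icc 0 T) t := by
  have hk : ContinuousOn (fun τ => us * pair (u τ) (deriv φ) + b * pair (ρ τ) (deriv φ)
      - (1 / ρs) * pair (S τ) (deriv φ)) (Icc 0 T) :=
    ((continuousOn_const.mul (continuousOn_pair hφ.deriv h.continuousOn_velocity)).add
      (continuousOn_const.mul (continuousOn_pair hφ.deriv h.continuousOn_density))).sub
      (continuousOn_const.mul (continuousOn_pair hφ.deriv h.continuousOn_stress))
  have he := h.velocity_eq φ hφ
  simp only [pair_eq_zero hO hφO, add_zero] at he
  exact ((hasDerivWithinAt_integral_of_continuousOn hk ht).const_add _).congr he (he t ht)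

theorem hasDerivWithinAt_stress (h : IsSolution b ρs us κ μ T f₁ f₂ f₃ ρ₀ u₀ S₀ ρ u S)
    (hO : MeasurableSet O) (hφ : IsTest φ) (hφO : ∀ x ∈ O, φ x = 0) (ht : t ∈ Icc 0 T) :
    HasDerivWithinAt (fun t => pair (S t) φ)
      (-(1 / κ) * pair (S t) φ - (μ / κ) * pair (u t) (deriv φ)) (Icc 0 T) t := by
  have hk : ContinuousOn (fun τ => -(1 / κ) * pair (S τ) φ - (μ / κ) * pair (u τ) (deriv φ))
      (Icc 0 T) :=
    (continuousOn_const.mul (continuousOn_pair hφ h.continuousOn_stress)).sub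
      (continuousOn_const.mul (continuousOn_pair hφ.deriv h.continuousOn_velocity))
  have he := h.stress_eq φ hφ
  simp only [pair_eq_zero hO hφO, add_zero] at he
  exact ((hasDerivWithinAt_integral_of_continuousOn hk ht).const_add _).congr he (he t ht)

end IsSolution

/-! ### Wave packets -/

/-- The oscillating factor `e^{inθ}`. -/
def oscillation (n : ℤ) (θ : ℝ) : ℂ := Complex.exp (n * Complex.I * θ)

theorem hasDerivAt_oscillation (n : ℤ) (θ : ℝ) :
    HasDerivAt (oscillation n) (n * Complex.I * oscillation n θ) θ := by
  have h := ((HasDerivAt.ofReal_comp (hasDerivAt_id θ)).const_mul (n * Complex.I)).cexp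
  rw [Complex.ofReal_one, mul_one, mul_comm (Complex.exp _)] at h
  exact h

theorem isTest_oscillation (n : ℤ) : IsTest (oscillation n) := by
  refine ⟨?_, fun θ => ?_⟩
  · unfold oscillation
    exact (contDiff_const.mul Complex.ofRealCLM.contDiff).cexp
  · rw [oscillation, oscillation, ← (Complex.exp_periodic.int_mul n) (n * Complex.I * θ)]
    congr 1
    push_cast
    ring

theorem norm_oscillation (n : ℤ) (θ : ℝ) : ‖oscillation n θ‖ = 1 := by
  rw [oscillation, show (n * Complex.I * θ : ℂ) = ((n * θ : ℝ) : ℂ) * Complex.I by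
    push_cast; ring, Complex.norm_exp_ofReal_mul_I]

theorem oscillation_neg_mul (n : ℤ) (θ : ℝ) : oscillation (-n) θ * oscillation n θ = 1 := by
  rw [oscillation, oscillation, ← Complex.exp_add]
  simp

/-- A solution starting from rest and ending in `(0, 0, S₁)` pairs to `O(1/n)` with a wave packet
of frequency `n` that travels with a characteristic speed and never meets the control region.
The vectors `v` and `w` are the amplitude of the wave packet and its first-order correction. -/
theorem IsSolution.exists_bound_wavePacket {b ρs us κ μ T : ℝ} {O : Set ℝ}
    {f₁ f₂ f₃ : ControlSpace T O} {ρ u S : ℝ → L2Per}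
    (h : IsSolution b ρs us κ μ T f₁ f₂ f₃ 0 0 0 ρ u S) (hT : 0 ≤ T) (hO : MeasurableSet O)
    (hρT : ρ T = 0) (huT : u T = 0) {g : ℝ → ℂ} (hg : IsTest g) {β : ℝ}
    (hgO : ∀ t ∈ Icc 0 T, ∀ x ∈ O, g (x + β * t) = 0) {v₁ v₂ v₃ w₁ w₂ c : ℂ} (hv₃ : v₃ ≠ 0)
    (e₁ : (us + β) * v₁ + b * v₂ = 0) (e₂ : ρs * v₁ + (us + β) * v₂ - μ / κ * v₃ = 0)
    (e₃ : -(1 / ρs) * v₂ + β * v₃ = 0) (e₄ : (us + β) * w₁ + b * w₂ = -c * v₁)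
    (e₅ : ρs * w₁ + (us + β) * w₂ = -c * v₂) (e₆ : -(1 / ρs) * w₂ = (1 / κ - c) * v₃) :
    ∃ K, ∀ n : ℕ, n * ‖pair (S T) fun x => oscillation n (x + β * T) * g (x + β * T)‖ ≤ K := by
  obtain ⟨C, hC0, hC⟩ := hg.exists_bound
  obtain ⟨C', hC'0, hC'⟩ := hg.deriv.exists_bound
  obtain ⟨Mρ, hMρ⟩ := isCompact_Icc.exists_bound_of_continuousOn h.continuousOn_density
  obtain ⟨Mu, hMu⟩ := isCompact_Icc.exists_bound_of_continuousOn h.continuousOn_velocity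
  obtain ⟨MS, hMS⟩ := isCompact_Icc.exists_bound_of_continuousOn h.continuousOn_stress
  set D := ‖pairL2‖ * (circleConst * C) with hD
  set D' := ‖pairL2‖ * (circleConst * C') with hD'
  have hD0 : 0 ≤ D := by have := circleConst_nonneg; positivity
  have hD'0 : 0 ≤ D' := by have := circleConst_nonneg; positivity
  -- A bound for the time derivative of `F` below; it must not depend on `n`.
  set L := Real.exp (‖c‖ * T) * (‖c * v₁‖ * (D' * Mρ) + ‖c * v₂‖ * (D' * Mu)
    + ‖(1 / κ - c) * v₃‖ * (D' * MS) + ‖c * w₁‖ * (D * Mρ) + ‖c * w₂‖ * (D * Mu)) with hL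
  refine ⟨L * T / (‖Complex.exp (c * T)‖ * ‖v₃‖), fun n => ?_⟩
  set G : ℝ → ℂ := fun θ => oscillation n θ * g θ with hGdef
  set E : ℝ → ℂ := fun θ => oscillation n θ * deriv g θ with hEdef
  have hG : IsTest G := (isTest_oscillation n).mul hg
  have hE : IsTest E := (isTest_oscillation n).mul hg.deriv
  have hdG : deriv G = fun θ => (n * Complex.I) * G θ + E θ := by
    ext θ
    refine ((hasDerivAt_oscillation n θ).mul (hg.differentiable θ).hasDerivAt).deriv.trans ?_
    simp only [hGdef, hEdef, Int.cast_natCast]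
    ring
  have hGO : ∀ t ∈ Icc 0 T, ∀ x ∈ O, G (x + β * t) = 0 := fun t ht x hx => by
    simp only [hGdef, hgO t ht x hx, mul_zero]
  have hdt : ∀ t, deriv (fun x => G (x + β * t)) = fun x => deriv G (x + β * t) := fun t =>
    funext fun x => deriv_comp_add_const ..
  have hpair : ∀ (y : L2Per) t, pair y (fun x => deriv G (x + β * t))
      = n * Complex.I * pair y (fun x => G (x + β * t)) + pair y (fun x => E (x + β * t)) :=
    fun y t => by
      rw [hdG]
      exact pair_const_mul_add (hG.translate _) (hE.translate _) _ _
  have hGC : ∀ θ, ‖G θ‖ ≤ C := fun θ => by simpa [hGdef, norm_oscillation] using hC θ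
  have hEC : ∀ θ, ‖E θ‖ ≤ C' := fun θ => by simpa [hEdef, norm_oscillation] using hC' θ
  have bG : ∀ {y : L2Per} {M : ℝ} (t : ℝ), ‖y‖ ≤ M → ‖pair y fun x => G (x + β * t)‖ ≤ D * M :=
    fun t hy => (norm_pair_le (hG.translate _) hC0 (fun x => hGC _) _).trans
      (mul_le_mul_of_nonneg_left hy hD0)
  have bE : ∀ {y : L2Per} {M : ℝ} (t : ℝ), ‖y‖ ≤ M → ‖pair y fun x => E (x + β * t)‖ ≤ D' * M :=
    fun t hy => (norm_pair_le (hE.translate _) hC'0 (fun x => hEC _) _).trans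
      (mul_le_mul_of_nonneg_left hy hD'0)
  -- Pairing of the solution with the corrected packet; the correction is normalised to have no
  -- third component.
  set F : ℝ → ℂ := fun t => Complex.exp (c * t) *
    ((n * Complex.I * v₁ + w₁) * pair (ρ t) (fun x => G (x + β * t))
      + (n * Complex.I * v₂ + w₂) * pair (u t) (fun x => G (x + β * t))
      + n * Complex.I * v₃ * pair (S t) (fun x => G (x + β * t))) with hF
  have hF' : ∀ t ∈ Icc 0 T, HasDerivWithinAt F (Complex.exp (c * t) *
      (-(c * v₁) * pair (ρ t) (fun x => E (x + β * t))
        + -(c * v₂) * pair (u t) (fun x => E (x + β * t))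
        + (1 / κ - c) * v₃ * pair (S t) (fun x => E (x + β * t))
        + c * w₁ * pair (ρ t) (fun x => G (x + β * t))
        + c * w₂ * pair (u t) (fun x => G (x + β * t)))) (Icc 0 T) t := by
    intro t ht
    have d₁ := hasDerivWithinAt_pair_translate h.continuousOn_density hG β ht
      (h.hasDerivWithinAt_density hO (hG.translate _) (hGO t ht) ht)
    have d₂ := hasDerivWithinAt_pair_translate h.continuousOn_velocity hG β ht
      (h.hasDerivWithinAt_velocity hO (hG.translate _) (hGO t ht) ht)
    have d₃ := hasDerivWithinAt_pair_translate h.continuousOn_stress hG β ht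
      (h.hasDerivWithinAt_stress hO (hG.translate _) (hGO t ht) ht)
    have d₀ : HasDerivWithinAt (fun t : ℝ => Complex.exp (c * t)) (Complex.exp (c * t) * c)
        (Icc 0 T) t := by
      have := ((HasDerivAt.ofReal_comp (hasDerivAt_id t)).const_mul c).cexp
      rw [Complex.ofReal_one, mul_one] at this
      exact this.hasDerivWithinAt
    rw [hdt, hpair, hpair] at d₁
    rw [hdt, hpair, hpair, hpair] at d₂
    rw [hdt, hpair, hpair] at d₃
    have d := d₀.mul (((d₁.const_mul (n * Complex.I * v₁ + w₁)).add
      (d₂.const_mul (n * Complex.I * v₂ + w₂))).add (d₃.const_mul (n * Complex.I * v₃)))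
    refine d.congr_deriv ?_
    simp only [Pi.add_apply]
    generalize pair (ρ t) (fun x => G (x + β * t)) = p₁
    generalize pair (u t) (fun x => G (x + β * t)) = p₂
    generalize pair (S t) (fun x => G (x + β * t)) = p₃
    generalize pair (ρ t) (fun x => E (x + β * t)) = q₁
    generalize pair (u t) (fun x => E (x + β * t)) = q₂
    generalize pair (S t) (fun x => E (x + β * t)) = q₃
    generalize Complex.exp (c * t) = X
    generalize (n : ℂ) * Complex.I = N
    -- `e₁`, `e₂`, `e₃` cancel the terms `N² pᵢ` and `N qᵢ`; `e₄`, `e₅`, `e₆` cancel the remaining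
    -- `N pᵢ`. What is left is bounded in `n`.
    linear_combination X * ((N * p₁ + q₁) * (N * e₁ + e₄) + (N * p₂ + q₂) * (N * e₂ + e₅)
      + (N * p₃ + q₃) * (N * e₃ + e₆))
  have key := norm_image_sub_le_of_norm_deriv_le_segment' hF' (C := L) (fun t ht => ?_) T ⟨hT, le_rfl⟩
  · have z : ∀ φ : ℝ → ℂ, IsTest φ → pair (0 : L2Per) φ = 0 := fun φ hφ => by
      rw [pair_eq_pairL2 hφ, map_zero, zero_apply]
    have hF0 : F 0 = 0 := by
      simp only [hF, h.initial_density, h.initial_velocity, h.initial_stress]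
      rw [z _ (hG.translate (β * 0))]
      simp only [mul_zero, add_zero]
    have hFT : F T = Complex.exp (c * T) * (n * Complex.I * v₃
        * pair (S T) (fun x => G (x + β * T))) := by
      simp only [hF, hρT, huT, z _ (hG.translate _), mul_zero, zero_add]
    rw [hF0, hFT, sub_zero, sub_zero] at key
    simp only [norm_mul, Complex.norm_I, Complex.norm_natCast, mul_one] at key
    rw [le_div_iff₀ (mul_pos (norm_pos_iff.2 (Complex.exp_ne_zero _)) (norm_pos_iff.2 hv₃))]
    refine le_trans (le_of_eq ?_) key
    ring
  · have ht' := Ico_subset_Icc_self ht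
    rw [norm_mul, hL]
    refine mul_le_mul ((Complex.norm_exp_le_exp_norm _).trans (Real.exp_le_exp.2 ?_)) ?_
      (norm_nonneg _) (Real.exp_pos _).le
    · rw [norm_mul, Complex.norm_real, Real.norm_of_nonneg ht.1]
      exact mul_le_mul_of_nonneg_left ht.2.le (norm_nonneg _)
    · refine norm_add_le_of_le (norm_add_le_of_le (norm_add_le_of_le (norm_add_le_of_le
        ?_ ?_) ?_) ?_) ?_
      all_goals rw [norm_mul]
      · rw [norm_neg]; exact mul_le_mul_of_nonneg_left (bE t (hMρ t ht')) (norm_nonneg _)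
      · rw [norm_neg]; exact mul_le_mul_of_nonneg_left (bE t (hMu t ht')) (norm_nonneg _)
      · exact mul_le_mul_of_nonneg_left (bE t (hMS t ht')) (norm_nonneg _)
      · exact mul_le_mul_of_nonneg_left (bG t (hMρ t ht')) (norm_nonneg _)
      · exact mul_le_mul_of_nonneg_left (bG t (hMu t ht')) (norm_nonneg _)

/-- Wave packets of high frequency are not small: their pairings with all elements of `L²(0, 2π)`
cannot decay like `1/n`. -/
theorem exists_unbounded_pair_wavePacket {g : ℝ → ℝ} (hg : IsTest fun x => (g x : ℂ)) {s : ℝ}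
    (hpos : 0 < ∫ x in Ioo 0 (2 * Real.pi), g (x + s)) :
    ∃ y : L2Per, ¬ ∃ K, ∀ n : ℕ, n * ‖pair y fun x => oscillation n (x + s) * g (x + s)‖ ≤ K := by
  by_contra! hb
  have hG : ∀ n : ℕ, IsTest fun x => oscillation n (x + s) * g (x + s) := fun n =>
    ((isTest_oscillation n).mul hg).translate s
  obtain ⟨C, hC⟩ := banach_steinhaus (g := fun n : ℕ => (n : ℂ) • pairL2.flip (hG n).toL2)
    (fun y => by
      obtain ⟨K, hK⟩ := hb y
      refine ⟨K, fun n => ?_⟩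
      simpa [pair_eq_pairL2 (hG n)] using hK n)
  set I := ∫ x in Ioo 0 (2 * Real.pi), g (x + s) with hI
  have hn : ∀ n : ℕ, n * I ≤ C * circleConst := fun n => by
    -- The conjugate oscillation has norm bounded in `n` and undoes the phase, so the pairing is the
    -- fixed number `I > 0`.
    have hy := (isTest_oscillation (-n)).translate s
    have h1 : pair hy.toL2 (fun x => oscillation n (x + s) * g (x + s)) = I := by
      rw [pair, hI, ← integral_complex_ofReal]
      refine integral_congr_ae ?_
      filter_upwards [hy.memLp.coeFn_toLp] with x hx
      rw [IsTest.toL2, hx, ← mul_assoc, oscillation_neg_mul, one_mul]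
    have h2 : ‖hy.toL2‖ ≤ circleConst := by
      simpa using hy.norm_toL2_le zero_le_one fun x => (norm_oscillation _ _).le
    have h3 := ((n : ℂ) • pairL2.flip (hG n).toL2).le_of_opNorm_le_of_le (hC n) h2
    rw [smul_apply, ContinuousLinearMap.flip_apply, ← pair_eq_pairL2, h1,
      norm_smul, Complex.norm_natCast, Complex.norm_real, Real.norm_of_nonneg hpos.le] at h3
    exact h3
  obtain ⟨n, hn'⟩ := exists_nat_gt (C * circleConst / I)
  rw [div_lt_iff₀ hpos] at hn'
  exact (hn n).not_gt hn'

/-- A smooth periodic bump supported near the antipode of `x₀` on the circle. -/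
theorem exists_bump {x₀ η s : ℝ} (hη0 : 0 ≤ η) (hη : η < Real.pi) :
    ∃ g : ℝ → ℝ, IsTest (fun x => (g x : ℂ)) ∧ (∀ x, |x - x₀| ≤ η → g x = 0) ∧
      0 < ∫ x in Ioo 0 (2 * Real.pi), g (x + s) := by
  have hc : ContDiff ℝ ∞ fun x => expNegInvGlue (Real.cos η - Real.cos (x - x₀)) :=
    expNegInvGlue.contDiff.comp
      (contDiff_const.sub (Real.contDiff_cos.comp (contDiff_id.sub contDiff_const)))
  have hp : Function.Periodic (fun x => expNegInvGlue (Real.cos η - Real.cos (x - x₀)))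
      (2 * Real.pi) := fun x => by
    simp only [add_sub_right_comm, Real.cos_add_two_pi]
  refine ⟨fun x => expNegInvGlue (Real.cos η - Real.cos (x - x₀)),
    ⟨Complex.ofRealCLM.contDiff.comp hc, fun x => congrArg _ (hp x)⟩, fun x hx => ?_, ?_⟩
  · refine expNegInvGlue.zero_of_nonpos (sub_nonpos.2 ?_)
    rw [← Real.cos_abs (x - x₀)]
    exact Real.cos_le_cos_of_nonneg_of_le_pi (abs_nonneg _) hη.le hx
  · rw [← integral_Ioc_eq_integral_Ioo, ← intervalIntegral.integral_of_le (by positivity)]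
    -- The bump is positive at the antipode `x₀ + π`; periodicity moves this point into the interval
    -- of integration.
    obtain ⟨y, hy, he⟩ := (show Function.Periodic (fun x =>
      expNegInvGlue (Real.cos η - Real.cos (x + s - x₀))) (2 * Real.pi) from fun x => by
        simpa only [add_right_comm] using hp (x + s)).exists_mem_Ico₀ (by positivity) (x₀ + Real.pi - s)
    refine intervalIntegral.integral_pos (by positivity)
      (hc.continuous.comp (continuous_id.add continuous_const)).continuousOn
      (fun x _ => expNegInvGlue.nonneg _) ⟨y, Ico_subset_Icc_self hy, ?_⟩
    refine lt_of_lt_of_eq ?_ he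
    refine expNegInvGlue.pos_of_pos (sub_pos.2 ?_)
    rw [show x₀ + Real.pi - s + s - x₀ = Real.pi by ring]
    exact Real.cos_lt_cos_of_nonneg_of_le_pi hη0 le_rfl hη

/-! ### Amplitudes and the characteristic cubic -/

theorem derivative_speedPoly_ne_zero {b ρs us κ μ : ℝ} (hb : 0 < b) (hρ : 0 < ρs) (hu : 0 < us)
    (hκ : 0 < κ) (hμ : 0 < μ) {r : ℝ} (hr : r ∈ (speedPoly b ρs us κ μ).roots) :
    (speedPoly b ρs us κ μ).derivative.eval r ≠ 0 := by
  obtain ⟨β₁, β₂, β₃, h, h12, h2, h3⟩ := exists_roots_speedPoly hb hρ hu hκ hμ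
  have hnd : (speedPoly b ρs us κ μ).roots.Nodup := by
    rw [h]
    simp only [Multiset.insert_eq_cons, Multiset.nodup_cons, Multiset.mem_cons,
      Multiset.mem_singleton, Multiset.nodup_singleton, and_true, not_or]
    exact ⟨⟨h12.ne, by linarith⟩, by linarith⟩
  have h0 := (Polynomial.mem_roots'.1 hr).1
  intro hd
  have := (Polynomial.one_lt_rootMultiplicity_iff_isRoot h0).2 ⟨(Polynomial.mem_roots'.1 hr).2, hd⟩
  rw [← Polynomial.count_roots] at this
  exact this.not_ge (Multiset.nodup_iff_count_le_one.1 hnd r)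

/-- Amplitude, first-order correction and growth rate of the wave packet that travels with the
characteristic speed `r`. -/
theorem exists_amplitudes {b ρs us κ μ : ℝ} (hb : 0 < b) (hρ : 0 < ρs) (hu : 0 < us)
    (hκ : 0 < κ) (hμ : 0 < μ) {r : ℝ} (hr : r ∈ (speedPoly b ρs us κ μ).roots) :
    ∃ v₁ v₂ v₃ w₁ w₂ c : ℝ, v₃ ≠ 0 ∧ (us + r) * v₁ + b * v₂ = 0 ∧
      ρs * v₁ + (us + r) * v₂ - μ / κ * v₃ = 0 ∧ -(1 / ρs) * v₂ + r * v₃ = 0 ∧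
      (us + r) * w₁ + b * w₂ = -c * v₁ ∧ ρs * w₁ + (us + r) * w₂ = -c * v₂ ∧
      -(1 / ρs) * w₂ = (1 / κ - c) * v₃ := by
  have hd := derivative_speedPoly_ne_zero hb hρ hu hκ hμ hr
  have he := (Polynomial.mem_roots'.1 hr).2
  simp only [speedPoly, Polynomial.IsRoot, Polynomial.eval_sub, Polynomial.eval_add,
    Polynomial.eval_mul, Polynomial.eval_pow, Polynomial.eval_X, Polynomial.eval_C] at he
  simp only [speedPoly, Polynomial.derivative_sub, Polynomial.derivative_add,
    Polynomial.derivative_mul, Polynomial.derivative_X_pow, Polynomial.derivative_C,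
    Polynomial.derivative_X, Polynomial.eval_sub, Polynomial.eval_add, Polynomial.eval_mul,
    Polynomial.eval_pow, Polynomial.eval_X, Polynomial.eval_C, Polynomial.eval_zero,
    Polynomial.eval_one] at hd
  set m := μ / (κ * ρs) with hm
  have hmκ : μ / κ = m * ρs := by rw [hm]; field_simp
  -- Up to a nonzero factor, the determinant of the leading-order system for `v`.
  have he' : r * (us + r) ^ 2 - b * ρs * r - m * (us + r) = 0 := by
    have : μ * us / (κ * ρs) = m * us := by rw [hm]; ring
    rw [this] at he
    linear_combination he
  have hs : us + r ≠ 0 := by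
    intro hs
    rw [hs] at he'
    have : r = 0 := by
      have : b * ρs * r = 0 := by linear_combination -he'
      simpa [hb.ne', hρ.ne'] using this
    linarith
  -- The coefficient of `c` after eliminating `w₁` and `w₂`. At a root it equals `us + r` times the
  -- derivative of the cubic, so a simple root makes the correction solvable.
  set D := (us + r) ^ 3 + r * (us + r) ^ 2 - b * ρs * (us + r) + b * ρs * r with hD
  have hD0 : D ≠ 0 := by
    have : D = (us + r) * (3 * r ^ 2 + 4 * us * r + us ^ 2 - b * ρs - m) := by
      linear_combination -he'
    rw [this]
    refine mul_ne_zero hs fun h => hd ?_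
    push_cast
    linear_combination h
  generalize 1 / κ = k
  obtain ⟨c, hc⟩ : ∃ c, c * D = ((us + r) ^ 2 - b * ρs) * (us + r) * k := ⟨_, div_mul_cancel₀ _ hD0⟩
  obtain ⟨x, hx⟩ : ∃ x, x * (us + r) = c * b * ρs * r := ⟨_, div_mul_cancel₀ _ hs⟩
  -- `v` spans the kernel of the leading-order system. The last equation gives `w₂`, the fourth
  -- gives `w₁`, and the fifth is the condition that fixes `c`.
  refine ⟨-(b * ρs * r), ρs * r * (us + r), us + r, x + b * ρs * (k - c),
    -ρs * (k - c) * (us + r), c, hs, by ring, ?_, ?_, ?_, ?_, ?_⟩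
  · rw [hmκ]; linear_combination ρs * he'
  · field_simp; ring
  · linear_combination hx
  · refine mul_left_cancel₀ hs ?_
    linear_combination ρs * hc + ρs * hx
  · field_simp

end MaxwellNS

end

/-! ### Conclusion -/

theorem mainTheorem5 (a γ ρs us κ μ : ℝ) (ha : 0 < a) (hγ : 1 ≤ γ) (hρs : 0 < ρs) (hus : 0 < us)
    (hκ : 0 < κ) (hμ : 0 < μ) (b : ℝ) (hb : b = a * γ * ρs ^ (γ - 2))
    (β₁ β₂ β₃ : ℝ) (hroots : (MaxwellNS.speedPoly b ρs us κ μ).roots = {β₁, β₂, β₃})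
    (β : ℝ) (hβ : β = min |β₁| (min |β₂| |β₃|))
    (l₁ l₂ : ℝ) (hl₁ : 0 ≤ l₁) (hl : l₁ < l₂) (hl₂ : l₂ < 2 * Real.pi)
    (T : ℝ) (hT : 0 < T) (hβT : β * T < max l₁ (2 * Real.pi - l₂)) :
    ¬ MaxwellNS.ExactlyControllable b ρs us κ μ T
        (Set.Ioo l₁ l₂) (Set.Ioo l₁ l₂) (Set.Ioo l₁ l₂) := by
  have hb0 : 0 < b := by rw [hb]; positivity
  obtain ⟨r, hr, hrβ⟩ : ∃ r ∈ (MaxwellNS.speedPoly b ρs us κ μ).roots, |r| = β := by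
    rw [hroots, hβ]
    simp only [Multiset.insert_eq_cons, Multiset.mem_cons, Multiset.mem_singleton,
      exists_eq_or_imp, exists_eq_left]
    rcases min_choice |β₁| (min |β₂| |β₃|) with h | h <;> rw [h]
    · exact .inl rfl
    · rcases min_choice |β₂| |β₃| with h' | h' <;> rw [h']
      exacts [.inr (.inl rfl), .inr (.inr rfl)]
  obtain ⟨v₁, v₂, v₃, w₁, w₂, c, hv₃, e₁, e₂, e₃, e₄, e₅, e₆⟩ :=
    MaxwellNS.exists_amplitudes hb0 hρs hus hκ hμ hr
  -- Only this weaker bound, by the length of the complement of the control interval on the circle,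
  -- is needed.
  have hβT' : β * T < l₁ + (2 * Real.pi - l₂) :=
    hβT.trans_le (max_le (by linarith) (by linarith))
  have hβ0 : 0 ≤ β := hrβ ▸ abs_nonneg r
  -- Centre and half-length of the arc swept by `x + r t` for `x` in the control interval and `t` in
  -- `[0, T]`.
  obtain ⟨g, hg, hg0, hgpos⟩ := MaxwellNS.exists_bump (x₀ := (l₁ + l₂) / 2 + r * T / 2)
    (η := (l₂ - l₁) / 2 + β * T / 2) (s := r * T) (by have := mul_nonneg hβ0 hT.le; linarith)
    (by linarith)
  obtain ⟨S₁, hS₁⟩ := MaxwellNS.exists_unbounded_pair_wavePacket hg hgpos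
  intro hctrl
  obtain ⟨f₁, f₂, f₃, ρ, u, S, hsol, hρT, huT, hST⟩ := hctrl 0 0 0 0 0 S₁
  refine hS₁ ?_
  rw [← hST]
  refine hsol.exists_bound_wavePacket (β := r) (v₁ := v₁) (v₂ := v₂) (v₃ := v₃) (w₁ := w₁)
    (w₂ := w₂) (c := c) hT.le measurableSet_Ioo hρT huT hg (fun t ht x hx => ?_)
    (by exact_mod_cast hv₃) (by exact_mod_cast e₁) (by exact_mod_cast e₂) (by exact_mod_cast e₃)
    (by exact_mod_cast e₄) (by exact_mod_cast e₅) (by exact_mod_cast e₆)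
  have h1 : |r * (t - T / 2)| ≤ β * (T / 2) := by
    rw [abs_mul, hrβ]
    refine mul_le_mul_of_nonneg_left (abs_le.2 ⟨?_, ?_⟩) hβ0 <;> linarith [ht.1, ht.2]
  have h2 : |x - (l₁ + l₂) / 2| ≤ (l₂ - l₁) / 2 :=
    abs_le.2 ⟨by linarith [hx.1], by linarith [hx.2]⟩
  rw [hg0 _ ?_, Complex.ofReal_zero]
  calc |x + r * t - ((l₁ + l₂) / 2 + r * T / 2)|
      = |(x - (l₁ + l₂) / 2) + r * (t - T / 2)| := by congr 1; ring
    _ ≤ |x - (l₁ + l₂) / 2| + |r * (t - T / 2)| := abs_add_le _ _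
    _ ≤ (l₂ - l₁) / 2 + β * T / 2 := by linarith
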